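/- Let $T=(T_1,\dots,T_n):\mathbb R^n\to\mathbb R^n$ be a non-constant polynomial map, $\deg T=\max_i\deg T_i\ge 1$, let $g_1,\dots,g_m\in\mathbb R[x]$, $x=(x_1,\dots,x_n)$, put $g_0=1$, and let $X=\{x\in\mathbb R^n: g_i(x)\ge 0,\ i=1,\dots,m\}$. Assume the Archimedean condition: there are $r\in\mathbb R$ and sums of squares of polynomials $\sigma_0,\dots,\sigma_m$ with $r^2-x^\top x=\sum_{i=0}^m\sigma_i g_i$ (so $X$ is compact). Write $\mathbb R^\infty$ for the space of real sequences $(y_\alpha)_{\alpha\in\mathbb N^n}$ with the product topology, and $\ell_y(f)=\sum_\alpha f_\alpha y_\alpha$ for a polynomial $f=\sum_\alpha f_\alpha x^\alpha$; put $T^\alpha=T_1^{\alpha_1}\cdots T_n^{\alpha_n}$. Let $F:\mathbb R^\infty\to(-\infty,+\infty]$ be convex and lower semicontinuous, and suppose that there is $d$ such that $F(y)$ depends only on the entries $y_\alpha$ with $|\alpha|\le d$. The infinite-dimensional problem is to minimize $F(y)$ over the moment sequences $y_\alpha=\int_X x^\alpha\,d\mu$, $\alpha\in\mathbb N^n$,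 of the nonnegative finite Borel measures $\mu$ on $X$, subject to $\ell_y(T^\alpha)=\ell_y(x^\alpha)$ for all $\alpha\in\mathbb N^n$ and $y_0=1$; let $p^\star\in[-\infty,+\infty]$ be its optimal value (the infimum). For $k\in\mathbb N$ let $d_k=k\deg T$. The relaxation of order $k$ is to minimize $F(y)$ over the truncated sequences $y=(y_\alpha)_{|\alpha|\le d_k}$ subject to $\ell_y(T^\alpha)=\ell_y(x^\alpha)$ for all $|\alpha|\le k$, $y_0=1$, and $M_{d_k}(g_i\,y)\succeq 0$ for $i=0,\dots,m$. Here $M_d(g\,y)$ is the localizing matrix with entries $\ell_y(g\,x^{\alpha}x^{\beta})$, $|\alpha|,|\beta|\le\lfloor(d-\deg g)/2\rfloor$ (the empty matrix if $d<\deg g$), and $F(y)$ is defined by extending the truncated sequence by zeros, which for $d_k\ge d$ does not matter. For all sufficiently large $k$ let $y^k$ be an optimal solution of the relaxation of order $k$. Then: 1. $\lim_{k\to\infty}F(y^k)=p^\star$. 2. There are a strictly increasing sequence $(k_i)$ and a Borel probability measure $\mu^\star$ on $X$ that is invariant, that is, $\mu^\star(T^{-1}(A))=\mu^\star(A)$ for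 all Borel $A\subset\mathbb R^n$, and whose moment sequence attains the minimum in the infinite-dimensional problem, such that $y^{k_i}_\alpha\to\int_X x^\alpha\,d\mu^\star$ for every $\alpha\in\mathbb N^n$. 3. If there is a unique invariant probability measure $\mu^\star$ on $X$ whose moment sequence attains the minimum in the infinite-dimensional problem, then $y^k_\alpha\to\int_X x^\alpha\,d\mu^\star$ for every $\alpha\in\mathbb N^n$. -/

import Mathlib

open MeasureTheory Filter Topology

noncomputable section

/-- Real sequences indexed by the multi-indices `α ∈ ℕⁿ`, with the product topology. -/
abbrev MomSeq (n : ℕ) : Type := (Fin n →₀ ℕ) → ℝ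

/-- Truncated sequences `(y_α)_{|α| ≤ d}`. -/
abbrev TruncSeq (n d : ℕ) : Type := {α : Fin n →₀ ℕ // α.degree ≤ d} → ℝ

/-- A truncated sequence, padded by zeros in the degrees above `d`. -/
def TruncSeq.extend {n d : ℕ} (y : TruncSeq n d) : MomSeq n :=
  fun α => if h : α.degree ≤ d then y ⟨α, h⟩ else 0

/-- The Riesz functional `ℓ_y(f) = ∑_α f_α y_α`. -/
def riesz {n : ℕ} (y : MomSeq n) (f : MvPolynomial (Fin n) ℝ) : ℝ :=
  ∑ α ∈ f.support, f.coeff α * y α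

/-- The family `g₀ = 1, g₁, …, g_m`. -/
def withUnit {n m : ℕ} (g : Fin m → MvPolynomial (Fin n) ℝ) :
    Fin (m + 1) → MvPolynomial (Fin n) ℝ :=
  Fin.cons 1 g

/-- The basic closed semialgebraic set `X = {x | g_i(x) ≥ 0 for all i}`. -/
def semialgSet {n m : ℕ} (g : Fin m → MvPolynomial (Fin n) ℝ) : Set (Fin n → ℝ) :=
  {x | ∀ i, 0 ≤ MvPolynomial.eval x (g i)}

/-- The Archimedean condition: `r² - xᵀx = ∑_{i=0}^m σ_i g_i` with `g₀ = 1` and all `σ_i` sums of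
squares of polynomials. -/
def ArchimedeanCond {n m : ℕ} (g : Fin m → MvPolynomial (Fin n) ℝ) : Prop :=
  ∃ (r : ℝ) (σ : Fin (m + 1) → MvPolynomial (Fin n) ℝ), (∀ i, IsSumSq (σ i)) ∧
    MvPolynomial.C (r ^ 2) - ∑ j, MvPolynomial.X j ^ 2 = ∑ i, σ i * withUnit g i

/-- The localizing matrix `M_d(g y) = ℓ_y(g v vᵀ)`, where `v` is the vector of the monomials of
degree at most `⌊(d - deg g) / 2⌋`, that is, of those `x^α` with `deg g + 2|α| ≤ d`. It is the empty
matrix if `d < deg g`. -/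
def locMatrix {n : ℕ} (d : ℕ) (g : MvPolynomial (Fin n) ℝ) (y : MomSeq n) :
    Matrix {α : Fin n →₀ ℕ // g.totalDegree + 2 * α.degree ≤ d}
      {α : Fin n →₀ ℕ // g.totalDegree + 2 * α.degree ≤ d} ℝ :=
  Matrix.of fun α β =>
    riesz y (g * (MvPolynomial.monomial α.1 1 * MvPolynomial.monomial β.1 1))

/-- The polynomial map `T : ℝⁿ → ℝⁿ`. -/
def polyMap {n : ℕ} (T : Fin n → MvPolynomial (Fin n) ℝ) (x : Fin n → ℝ) : Fin n → ℝ :=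
  fun i => MvPolynomial.eval x (T i)

/-- The polynomial `T^α = T₁^α₁ ⋯ T_n^α_n`. -/
def polyPow {n : ℕ} (T : Fin n → MvPolynomial (Fin n) ℝ) (α : Fin n →₀ ℕ) :
    MvPolynomial (Fin n) ℝ :=
  ∏ i, T i ^ α i

/-- `deg T = max_i deg T_i`. -/
def mapDegree {n : ℕ} (T : Fin n → MvPolynomial (Fin n) ℝ) : ℕ :=
  Finset.univ.sup fun i => (T i).totalDegree

/-- The moments `y_α = ∫ x^α dμ`. -/
def momentSeq {n : ℕ} (μ : Measure (Fin n → ℝ)) : MomSeq n :=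
  fun α => ∫ x, ∏ i, x i ^ α i ∂μ

/-- The cone `M(X)` of moment sequences of finite Borel measures carried by `X`. -/
def momentCone {n : ℕ} (X : Set (Fin n → ℝ)) : Set (MomSeq n) :=
  {y | ∃ μ : Measure (Fin n → ℝ), IsFiniteMeasure μ ∧ μ Xᶜ = 0 ∧ y = momentSeq μ}

/-- The feasible set of the infinite-dimensional problem: `y ∈ M(X)`, `A(y) = 0`, `y₀ = 1`. -/
def lpFeasible {n m : ℕ} (T : Fin n → MvPolynomial (Fin n) ℝ)
    (g : Fin m → MvPolynomial (Fin n) ℝ) : Set (MomSeq n) :=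
  {y | y ∈ momentCone (semialgSet g) ∧
    (∀ α, riesz y (polyPow T α) = riesz y (MvPolynomial.monomial α 1)) ∧ y 0 = 1}

/-- The optimal value `p*` of the infinite-dimensional problem. -/
def lpValue {n m : ℕ} (T : Fin n → MvPolynomial (Fin n) ℝ)
    (g : Fin m → MvPolynomial (Fin n) ℝ) (F : MomSeq n → EReal) : EReal :=
  ⨅ y ∈ lpFeasible T g, F y

/-- `μ` is an invariant probability measure on `X` which attains the minimum in the
infinite-dimensional problem. -/
structure IsOptimalInvariant {n m : ℕ} (T : Fin n → MvPolynomial (Fin n) ℝ)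
    (g : Fin m → MvPolynomial (Fin n) ℝ) (F : MomSeq n → EReal)
    (μ : Measure (Fin n → ℝ)) : Prop where
  prob : IsProbabilityMeasure μ
  carried : μ (semialgSet g)ᶜ = 0
  invariant : ∀ A : Set (Fin n → ℝ), MeasurableSet A → μ (polyMap T ⁻¹' A) = μ A
  feasible : momentSeq μ ∈ lpFeasible T g
  optimal : ∀ z ∈ lpFeasible T g, F (momentSeq μ) ≤ F z

/-- The truncation degree `d_k = k deg T`. -/
def relaxDegree {n : ℕ} (T : Fin n → MvPolynomial (Fin n) ℝ) (k : ℕ) : ℕ :=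
  k * mapDegree T

/-- The feasible set of the relaxation of order `k`. -/
def relaxFeasible {n m : ℕ} (T : Fin n → MvPolynomial (Fin n) ℝ)
    (g : Fin m → MvPolynomial (Fin n) ℝ) (k : ℕ) : Set (TruncSeq n (relaxDegree T k)) :=
  {y | (∀ α : Fin n →₀ ℕ, α.degree ≤ k →
      riesz y.extend (polyPow T α) = riesz y.extend (MvPolynomial.monomial α 1)) ∧
    y.extend 0 = 1 ∧
    ∀ i, (locMatrix (relaxDegree T k) (withUnit g i) y.extend).PosSemidef}

/-- `y` is an optimal solution of the relaxation of order `k`. -/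
def IsRelaxSolution {n m : ℕ} (T : Fin n → MvPolynomial (Fin n) ℝ)
    (g : Fin m → MvPolynomial (Fin n) ℝ) (F : MomSeq n → EReal) (k : ℕ)
    (y : TruncSeq n (relaxDegree T k)) : Prop :=
  y ∈ relaxFeasible T g k ∧ ∀ z ∈ relaxFeasible T g k, F y.extend ≤ F z.extend

/-- Convexity of an extended-real-valued function: its epigraph is convex. -/
def ConvexEReal {n : ℕ} (F : MomSeq n → EReal) : Prop :=
  Convex ℝ {p : MomSeq n × ℝ | F p.1 ≤ (p.2 : EReal)}

/-- `F` depends only on the entries `y_α` with `|α| ≤ d`. -/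
def DependsOnDegreeLE {n : ℕ} (F : MomSeq n → EReal) (d : ℕ) : Prop :=
  ∀ y z : MomSeq n, (∀ α : Fin n →₀ ℕ, α.degree ≤ d → y α = z α) → F y = F z

end

/-! The argument is compactness plus Putinar's theorem. Multiplying the Archimedean identity by
squares bounds every moment, `|y_α| ≤ R^|α|`, once the order is large, with `R` independent of the
order. A subsequence of the optimal solutions thus converges entrywise. Each fixed constraint is
eventually imposed, so the limit is nonnegative on the quadratic module and satisfies all invariance
equations; it is therefore the moment sequence of a measure on `X`, which is invariant because
moments determine measures on compact sets. Truncations of feasible points are feasible for the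
relaxations, so eventually `F(y^k) ≤ p*`; lower semicontinuity makes the limit optimal and gives the
reverse bound. Putinar's theorem (`exists_eq_momentSeq`) is obtained from Krein–Milman: the extreme
normalized positive functionals are multiplicative, hence evaluations at points of `X`. -/

section

open MvPolynomial

/-! ### The Riesz functional and localizing matrices -/

/-- The Riesz functional as a linear map. -/
noncomputable def rieszLin {n : ℕ} (y : MomSeq n) : MvPolynomial (Fin n) ℝ →ₗ[ℝ] ℝ :=
  (basisMonomials (Fin n) ℝ).constr ℝ y

theorem rieszLin_monomial {n : ℕ} (y : MomSeq n) (α : Fin n →₀ ℕ) (c : ℝ) :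
    rieszLin y (monomial α c) = c * y α := by
  have h : monomial α c = c • basisMonomials (Fin n) ℝ α := by simp [smul_monomial]
  rw [h, map_smul, rieszLin, Module.Basis.constr_basis, smul_eq_mul]

theorem rieszLin_apply {n : ℕ} (y : MomSeq n) (f : MvPolynomial (Fin n) ℝ) :
    rieszLin y f = riesz y f := by
  conv_lhs => rw [f.as_sum]
  rw [map_sum, riesz]
  exact Finset.sum_congr rfl fun α _ => rieszLin_monomial y α _

theorem linearMap_eq_rieszLin {n : ℕ} (L : MvPolynomial (Fin n) ℝ →ₗ[ℝ] ℝ) :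
    rieszLin (fun α => L (monomial α 1)) = L := by
  refine (basisMonomials (Fin n) ℝ).ext fun α => ?_
  simp [rieszLin_monomial]

theorem rieszLin_congr {n d : ℕ} {y z : MomSeq n} (h : ∀ α : Fin n →₀ ℕ, α.degree ≤ d → y α = z α)
    {f : MvPolynomial (Fin n) ℝ} (hf : f.totalDegree ≤ d) : rieszLin y f = rieszLin z f := by
  rw [rieszLin_apply, rieszLin_apply]
  refine Finset.sum_congr rfl fun α hα => ?_
  rw [h α ((le_totalDegree hα).trans hf)]

theorem continuous_rieszLin {n : ℕ} (f : MvPolynomial (Fin n) ℝ) :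
    Continuous fun y : MomSeq n => rieszLin y f := by
  simp_rw [rieszLin_apply, riesz]
  fun_prop

theorem rieszLin_add_smul {n : ℕ} (a b : ℝ) (y z : MomSeq n) :
    rieszLin (a • y + b • z) = a • rieszLin y + b • rieszLin z := by
  refine (basisMonomials (Fin n) ℝ).ext fun α => ?_
  simp [rieszLin_monomial]

theorem totalDegree_monomial_one {n : ℕ} (α : Fin n →₀ ℕ) :
    (monomial α (1 : ℝ)).totalDegree = α.degree := by
  rw [totalDegree_monomial _ one_ne_zero]; rfl

theorem sum_locMatrix {n d : ℕ} (g : MvPolynomial (Fin n) ℝ) (y : MomSeq n)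
    (x : {α : Fin n →₀ ℕ // g.totalDegree + 2 * α.degree ≤ d} →₀ ℝ) :
    (x.sum fun i xi => x.sum fun j xj => star xi * locMatrix d g y i j * xj) =
      rieszLin y (g * (x.sum fun i xi => monomial i.1 xi) ^ 2) := by
  simp only [Finsupp.sum, pow_two]
  rw [Finset.sum_mul_sum, Finset.mul_sum, map_sum]
  refine Finset.sum_congr rfl fun i _ => ?_
  rw [Finset.mul_sum, map_sum]
  refine Finset.sum_congr rfl fun j _ => ?_
  have h : g * (monomial i.1 (x i) * monomial j.1 (x j)) =
      (x i * x j) • (g * (monomial i.1 1 * monomial j.1 1)) := by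
    rw [monomial_mul, monomial_mul, mul_one, ← mul_smul_comm, smul_monomial, smul_eq_mul, mul_one]
  rw [h, map_smul, rieszLin_apply, locMatrix, Matrix.of_apply, star_trivial, smul_eq_mul]
  ring

/-- The quadratic form of the matrix at the coefficient vector of `p` is `ℓ_y(g p²)`. -/
theorem posSemidef_locMatrix_iff {n d : ℕ} (g : MvPolynomial (Fin n) ℝ) (y : MomSeq n) :
    (locMatrix d g y).PosSemidef ↔
      ∀ p : MvPolynomial (Fin n) ℝ, g.totalDegree + 2 * p.totalDegree ≤ d →
        0 ≤ rieszLin y (g * p ^ 2) := by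
  constructor
  · intro h p hp
    have hmem : ∀ α ∈ p.support, g.totalDegree + 2 * α.degree ≤ d := fun α hα => by
      have : α.degree ≤ p.totalDegree := le_totalDegree hα
      omega
    let x : {α : Fin n →₀ ℕ // g.totalDegree + 2 * α.degree ≤ d} →₀ ℝ :=
      ∑ α ∈ p.support.attach, Finsupp.single ⟨α.1, hmem α.1 α.2⟩ (p.coeff α.1)
    have hx : (x.sum fun i xi => monomial i.1 xi) = p := by
      have h1 : ∀ z : {α : Fin n →₀ ℕ // g.totalDegree + 2 * α.degree ≤ d} →₀ ℝ,
          (z.sum fun i xi => monomial i.1 xi) =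
            Finsupp.lsum ℝ (fun i : {α : Fin n →₀ ℕ // g.totalDegree + 2 * α.degree ≤ d} =>
              (monomial i.1 : ℝ →ₗ[ℝ] MvPolynomial (Fin n) ℝ)) z := fun z => rfl
      rw [h1, map_sum]
      simp only [Finsupp.lsum_single]
      rw [Finset.sum_attach p.support fun α => monomial α (p.coeff α)]
      exact p.as_sum.symm
    have := h.2 x
    rwa [sum_locMatrix, hx] at this
  · intro h
    refine ⟨?_, fun x => ?_⟩
    · ext i j
      simp only [locMatrix, Matrix.conjTranspose_apply, Matrix.of_apply, star_trivial]
      rw [mul_comm (monomial j.1 1)]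
    · rw [sum_locMatrix]
      -- A nonzero `x` provides an index, hence `deg g ≤ d`; otherwise the truncated subtraction
      -- below would lose the degree bound.
      rcases eq_or_ne x 0 with rfl | hx
      · simp
      · obtain ⟨β, -⟩ := Finsupp.support_nonempty_iff.2 hx
        refine h _ ?_
        have hdeg : (x.sum fun i xi => monomial i.1 xi).totalDegree ≤ (d - g.totalDegree) / 2 := by
          refine totalDegree_finsetSum_le fun i _ => (totalDegree_monomial_le _ _).trans ?_
          have := i.2
          change i.1.degree ≤ _
          omega
        have := β.2
        omega

/-! ### Moment bounds from the Archimedean condition -/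

/-- Nonnegativity on the squares times the `g_i`, as far as the degrees stay at most `D`. -/
def NonnegUpTo {n m : ℕ} (g : Fin m → MvPolynomial (Fin n) ℝ) (D : ℕ)
    (L : MvPolynomial (Fin n) ℝ →ₗ[ℝ] ℝ) : Prop :=
  ∀ i p, (withUnit g i).totalDegree + 2 * p.totalDegree ≤ D → 0 ≤ L (withUnit g i * p ^ 2)

theorem NonnegUpTo.sq {n m D : ℕ} {g : Fin m → MvPolynomial (Fin n) ℝ}
    {L : MvPolynomial (Fin n) ℝ →ₗ[ℝ] ℝ} (h : NonnegUpTo g D L) {p : MvPolynomial (Fin n) ℝ}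
    (hp : 2 * p.totalDegree ≤ D) : 0 ≤ L (p ^ 2) := by
  have := h 0 p (by simpa [withUnit] using hp)
  simpa [withUnit] using this

/-- Since `a² g_i p² = g_i (a p)²`, each square in `σ` only costs degree. The cost `D₀` is uniform
in `L`, `p` and `D`. -/
theorem exists_nonneg_isSumSq_mul {n m : ℕ} (g : Fin m → MvPolynomial (Fin n) ℝ) (i : Fin (m + 1))
    {σ : MvPolynomial (Fin n) ℝ} (hσ : IsSumSq σ) :
    ∃ D₀, ∀ D L, NonnegUpTo g D L → ∀ p : MvPolynomial (Fin n) ℝ, 2 * p.totalDegree + D₀ ≤ D →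
      0 ≤ L (σ * withUnit g i * p ^ 2) := by
  induction hσ with
  | zero => exact ⟨0, fun D L _ p _ => by simp⟩
  | sq_add a _ ih =>
    obtain ⟨D₀, hD₀⟩ := ih
    refine ⟨D₀ + 2 * a.totalDegree + (withUnit g i).totalDegree, fun D L hL p hp => ?_⟩
    rw [add_mul, add_mul, map_add]
    refine add_nonneg ?_ (hD₀ D L hL p (by omega))
    rw [show a * a * withUnit g i * p ^ 2 = withUnit g i * (a * p) ^ 2 by ring]
    have := totalDegree_mul a p
    exact hL i _ (by omega)

theorem ArchimedeanCond.exists_mul_sq_le {n m : ℕ} {g : Fin m → MvPolynomial (Fin n) ℝ}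
    (hg : ArchimedeanCond g) :
    ∃ R : ℝ, 1 ≤ R ∧ ∃ D₀, ∀ D L, NonnegUpTo g D L → ∀ (j : Fin n) (p : MvPolynomial (Fin n) ℝ),
      2 * p.totalDegree + D₀ ≤ D → L (X j ^ 2 * p ^ 2) ≤ R ^ 2 * L (p ^ 2) := by
  obtain ⟨r, σ, hσ, h⟩ := hg
  choose E hE using fun i => exists_nonneg_isSumSq_mul g i (hσ i)
  -- The `2` pays for the factor `X j` inside a square; the sum dominates every `E i`.
  refine ⟨max 1 |r|, le_max_left _ _, 2 + ∑ i, E i, fun D L hL j p hp => ?_⟩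
  have h1 : 0 ≤ L ((C (r ^ 2) - ∑ j, X j ^ 2) * p ^ 2) := by
    rw [h, Finset.sum_mul, map_sum]
    refine Finset.sum_nonneg fun i _ => hE i D L hL p ?_
    have := Finset.single_le_sum (f := E) (fun _ _ => Nat.zero_le _) (Finset.mem_univ i)
    omega
  rw [sub_mul, map_sub, Finset.sum_mul, map_sum, C_mul', map_smul, smul_eq_mul] at h1
  have h2 : L (X j ^ 2 * p ^ 2) ≤ ∑ j, L (X j ^ 2 * p ^ 2) := by
    refine Finset.single_le_sum (f := fun j => L (X j ^ 2 * p ^ 2)) (fun j _ => ?_)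
      (Finset.mem_univ j)
    rw [← mul_pow]
    have := totalDegree_mul (X j) p
    rw [totalDegree_X] at this
    exact hL.sq (by omega)
  have h3 : r ^ 2 ≤ max 1 |r| ^ 2 := by
    rw [← sq_abs]
    exact pow_le_pow_left₀ (abs_nonneg _) (le_max_right _ _) 2
  have := mul_le_mul_of_nonneg_right h3 (hL.sq (p := p) (by omega))
  linarith

/-- Removing one variable at a time bounds `L(x^(2α))`; a Cauchy–Schwarz argument then bounds
`L(x^α)`. -/
theorem abs_apply_monomial_le {n m D₀ D : ℕ} {g : Fin m → MvPolynomial (Fin n) ℝ} {R : ℝ}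
    (hR : 1 ≤ R) {L : MvPolynomial (Fin n) ℝ →ₗ[ℝ] ℝ} (hL : NonnegUpTo g D L) (h1 : L 1 = 1)
    (hX : ∀ (j : Fin n) (p : MvPolynomial (Fin n) ℝ),
      2 * p.totalDegree + D₀ ≤ D → L (X j ^ 2 * p ^ 2) ≤ R ^ 2 * L (p ^ 2))
    (α : Fin n →₀ ℕ) (hα : 2 * α.degree + D₀ ≤ D) : |L (monomial α 1)| ≤ R ^ α.degree := by
  have key : ∀ (k : ℕ) (α : Fin n →₀ ℕ), α.degree = k → 2 * α.degree + D₀ ≤ D →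
      L (monomial α 1 ^ 2) ≤ (R ^ k) ^ 2 := by
    intro k
    induction k with
    | zero =>
      intro α hk _
      rw [(Finsupp.degree_eq_zero_iff α).1 hk]
      simp [h1]
    | succ k ih =>
      intro α hk hα
      obtain ⟨j, hj⟩ : ∃ j, α j ≠ 0 := by
        by_contra! h0
        have : α = 0 := Finsupp.ext h0
        simp [this] at hk
      have hle : Finsupp.single j 1 ≤ α := Finsupp.single_le_iff.2 (Nat.one_le_iff_ne_zero.2 hj)
      obtain ⟨β, rfl⟩ := exists_add_of_le hle
      rw [map_add, Finsupp.degree_single] at hk hα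
      have hm : (monomial (Finsupp.single j 1 + β) (1 : ℝ)) ^ 2 = X j ^ 2 * monomial β 1 ^ 2 := by
        rw [X, ← mul_pow, monomial_mul, one_mul]
      rw [hm]
      have hβ := ih β (by omega) (by omega)
      have := hX j (monomial β 1) (by rw [totalDegree_monomial_one]; omega)
      calc _ ≤ _ := this
        _ ≤ R ^ 2 * (R ^ k) ^ 2 := by gcongr
        _ = _ := by ring
  have h2 := key _ α rfl hα
  set t := R ^ α.degree with ht
  have ht0 : 0 < t := by positivity
  have hs : ∀ s : ℝ, 0 ≤ s ^ 2 + 2 * s * L (monomial α 1) + L (monomial α 1 ^ 2) := by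
    intro s
    have hd : (C s + monomial α 1 : MvPolynomial (Fin n) ℝ).totalDegree ≤ α.degree := by
      refine (totalDegree_add _ _).trans ?_
      rw [totalDegree_C, totalDegree_monomial_one]
      simp
    have h0 := hL.sq (p := C s + monomial α 1) (by omega)
    have he : (C s + monomial α 1 : MvPolynomial (Fin n) ℝ) ^ 2 =
        (s ^ 2) • 1 + (2 * s) • monomial α 1 + monomial α 1 ^ 2 := by
      simp only [smul_eq_C_mul, map_mul, map_pow, map_ofNat]
      ring
    rw [he, map_add, map_add, map_smul, map_smul, h1] at h0
    simpa using h0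
  -- With `s = ±t` and `L(x^(2α)) ≤ t²`, this reads `0 ≤ 2t² ± 2t L(x^α)`.
  have hp := hs t
  have hn := hs (-t)
  rw [abs_le]
  constructor <;> nlinarith

/-! ### The compact convex set of positive functionals -/

/-- The normalized functionals that are nonnegative on the quadratic module of `g`. -/
def positiveSeqs {n m : ℕ} (g : Fin m → MvPolynomial (Fin n) ℝ) : Set (MomSeq n) :=
  {y | y 0 = 1 ∧ ∀ i p, 0 ≤ rieszLin y (withUnit g i * p ^ 2)}

theorem rieszLin_one {n : ℕ} (y : MomSeq n) : rieszLin y 1 = y 0 := by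
  have := rieszLin_monomial y 0 1
  rwa [one_mul] at this

theorem convex_positiveSeqs {n m : ℕ} (g : Fin m → MvPolynomial (Fin n) ℝ) :
    Convex ℝ (positiveSeqs g) := by
  intro y hy z hz a b ha hb hab
  refine ⟨by simp [hy.1, hz.1, hab], fun i p => ?_⟩
  rw [rieszLin_add_smul]
  simp only [LinearMap.add_apply, LinearMap.smul_apply, smul_eq_mul]
  have := hy.2 i p
  have := hz.2 i p
  positivity

theorem ArchimedeanCond.exists_abs_le {n m : ℕ} {g : Fin m → MvPolynomial (Fin n) ℝ}
    (hg : ArchimedeanCond g) :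
    ∃ R : ℝ, 1 ≤ R ∧ ∃ D₀, ∀ (D : ℕ) (y : MomSeq n), NonnegUpTo g D (rieszLin y) → y 0 = 1 →
      ∀ α : Fin n →₀ ℕ, 2 * α.degree + D₀ ≤ D → |y α| ≤ R ^ α.degree := by
  obtain ⟨R, hR, D₀, h⟩ := hg.exists_mul_sq_le
  refine ⟨R, hR, D₀, fun D y hy h0 α hα => ?_⟩
  have := abs_apply_monomial_le hR hy (by rw [rieszLin_one, h0]) (h D _ hy) α hα
  rwa [rieszLin_monomial, one_mul] at this

theorem ArchimedeanCond.exists_abs_le_of_mem {n m : ℕ} {g : Fin m → MvPolynomial (Fin n) ℝ}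
    (hg : ArchimedeanCond g) :
    ∃ R : ℝ, 1 ≤ R ∧ ∀ y ∈ positiveSeqs g, ∀ α : Fin n →₀ ℕ, |y α| ≤ R ^ α.degree := by
  obtain ⟨R, hR, D₀, h⟩ := hg.exists_abs_le
  exact ⟨R, hR, fun y hy α => h _ y (fun i p _ => hy.2 i p) hy.1 α le_rfl⟩

theorem ArchimedeanCond.isCompact_positiveSeqs {n m : ℕ} {g : Fin m → MvPolynomial (Fin n) ℝ}
    (hg : ArchimedeanCond g) : IsCompact (positiveSeqs g) := by
  obtain ⟨R, -, h⟩ := hg.exists_abs_le_of_mem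
  have hc : IsCompact (Set.univ.pi fun α : Fin n →₀ ℕ => Set.Icc (-R ^ α.degree) (R ^ α.degree)) :=
    isCompact_univ_pi fun _ => isCompact_Icc
  refine hc.of_isClosed_subset ?_ fun y hy α _ => abs_le.1 (h y hy α)
  have : positiveSeqs g =
      {y | y 0 = 1} ∩ ⋂ i, ⋂ p, {y | 0 ≤ rieszLin y (withUnit g i * p ^ 2)} := by
    ext y; simp [positiveSeqs]
  rw [this]
  exact (isClosed_eq (continuous_apply 0) continuous_const).inter <| isClosed_iInter fun i =>
    isClosed_iInter fun p => isClosed_le continuous_const (continuous_rieszLin _)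

/-! ### Extreme positive functionals are point evaluations -/

theorem exists_abs_apply_mul_X_pow_le {n : ℕ} {L : MvPolynomial (Fin n) ℝ →ₗ[ℝ] ℝ} {R : ℝ}
    (hL : ∀ α : Fin n →₀ ℕ, |L (monomial α 1)| ≤ R ^ α.degree) (j : Fin n)
    (q : MvPolynomial (Fin n) ℝ) : ∃ K, ∀ k, |L (X j ^ k * q)| ≤ K * R ^ k := by
  refine ⟨∑ α ∈ q.support, |q.coeff α| * R ^ α.degree, fun k => ?_⟩
  conv_lhs => rw [q.as_sum]
  rw [Finset.mul_sum, map_sum, Finset.sum_mul]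
  refine (Finset.abs_sum_le_sum_abs _ _).trans (Finset.sum_le_sum fun α _ => ?_)
  have h : X j ^ k * monomial α (q.coeff α) =
      q.coeff α • monomial (Finsupp.single j k + α) (1 : ℝ) := by
    rw [X_pow_eq_monomial, monomial_mul, smul_monomial, one_mul, smul_eq_mul, mul_one]
  rw [h, map_smul, smul_eq_mul, abs_mul, mul_assoc, ← pow_add]
  gcongr
  refine (hL _).trans (le_of_eq ?_)
  rw [map_add, Finsupp.degree_single, add_comm]

/-- A sequence with `a (k+2) - 2 q a (k+1) + q² a k ≥ 0` for `q > R²` that does not outgrow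
`R^(2k)` satisfies `a 1 ≤ R² a 0`. -/
theorem le_mul_of_second_difference_nonneg {a : ℕ → ℝ} {s K : ℝ} (hs : 0 < s) (ha : ∀ k, 0 ≤ a k)
    (h : ∀ q, 0 ≤ q → ∀ k, 0 ≤ a (k + 2) - 2 * q * a (k + 1) + q ^ 2 * a k)
    (hK : ∀ k, a k ≤ K * s ^ k) : a 1 ≤ s * a 0 := by
  by_contra! hlt
  obtain ⟨q, hq, hqs⟩ : ∃ q, s < q ∧ q * a 0 < a 1 := by
    have hc : ContinuousAt (fun q : ℝ => q * a 0) s := by fun_prop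
    have h1 : ∀ᶠ q in 𝓝[>] s, q * a 0 < a 1 :=
      (hc.eventually_lt continuousAt_const hlt).filter_mono nhdsWithin_le_nhds
    obtain ⟨q, hq1, hq2⟩ := (h1.and self_mem_nhdsWithin).exists
    exact ⟨q, hq2, hq1⟩
  have hq0 : 0 < q := hs.trans hq
  -- The differences `b k = a (k+1) - q a k` satisfy `b (k+1) ≥ q b k`, and `b 0 > 0`: growth of
  -- order `q^k`, against the bound of order `s^k` with `s < q`.
  have hb : ∀ k, q ^ k * (a 1 - q * a 0) ≤ a (k + 1) - q * a k := by
    intro k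
    induction k with
    | zero => simp
    | succ k ih =>
      have := h q hq0.le k
      have := mul_le_mul_of_nonneg_left ih hq0.le
      rw [pow_succ]
      linarith
  have hgrow : ∀ k, (q / s) ^ k * (a 1 - q * a 0) ≤ K * s := by
    intro k
    rw [div_pow, div_mul_eq_mul_div, div_le_iff₀ (by positivity)]
    have h1 := hb k
    have h2 := mul_nonneg hq0.le (ha k)
    have h3 := hK (k + 1)
    rw [pow_succ] at h3
    linarith
  have hpos : 0 < a 1 - q * a 0 := by linarith
  obtain ⟨k, hk⟩ := pow_unbounded_of_one_lt (K * s / (a 1 - q * a 0)) ((one_lt_div hs).2 hq)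
  rw [div_lt_iff₀ hpos] at hk
  linarith [hgrow k]

/-- Multiplying the Archimedean identity by `g_i p²` would create products `g_i g_k`, which need not
lie in the quadratic module. Instead, the growth of `ℓ_y(g_i x_j^(2k) p²)` in `k` is compared with
the moment bound. -/
theorem positiveSeqs_mul_X_sq_le {n m : ℕ} {g : Fin m → MvPolynomial (Fin n) ℝ} {y : MomSeq n}
    (hy : y ∈ positiveSeqs g) {R : ℝ} (hR : 0 < R) (hyR : ∀ α : Fin n →₀ ℕ, |y α| ≤ R ^ α.degree)
    (i : Fin (m + 1)) (j : Fin n) (p : MvPolynomial (Fin n) ℝ) :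
    rieszLin y (withUnit g i * (X j * p) ^ 2) ≤ R ^ 2 * rieszLin y (withUnit g i * p ^ 2) := by
  obtain ⟨K, hK⟩ := exists_abs_apply_mul_X_pow_le (L := rieszLin y)
    (fun α => by rw [rieszLin_monomial, one_mul]; exact hyR α) j (withUnit g i * p ^ 2)
  have key := le_mul_of_second_difference_nonneg
    (a := fun k => rieszLin y (withUnit g i * (X j ^ k * p) ^ 2)) (s := R ^ 2) (K := K)
    (by positivity) (fun k => hy.2 i _) (fun q _ k => ?_) (fun k => ?_)
  · simpa using key
  · have h := hy.2 i ((X j ^ 2 - C q) * (X j ^ k * p))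
    have he : withUnit g i * ((X j ^ 2 - C q) * (X j ^ k * p)) ^ 2 =
        withUnit g i * (X j ^ (k + 2) * p) ^ 2 - (2 * q) • (withUnit g i * (X j ^ (k + 1) * p) ^ 2)
          + (q ^ 2) • (withUnit g i * (X j ^ k * p) ^ 2) := by
      simp only [smul_eq_C_mul, map_mul, map_pow, map_ofNat]
      ring
    rw [he, map_add, map_sub, map_smul, map_smul] at h
    simpa using h
  · have := (le_abs_self _).trans (hK (2 * k))
    rwa [pow_mul R, pow_mul', show (X j ^ k) ^ 2 * (withUnit g i * p ^ 2) =
      withUnit g i * (X j ^ k * p) ^ 2 by ring] at this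

/-- From `2R(R + s x_j) = (R + s x_j)² + (R² - x_j²)` for `s² = 1`, where both terms on the right
are nonnegative against `g_i p²`. -/
theorem positiveSeqs_mul_linear_nonneg {n m : ℕ} {g : Fin m → MvPolynomial (Fin n) ℝ}
    {y : MomSeq n} (hy : y ∈ positiveSeqs g) {R : ℝ} (hR : 0 < R)
    (hyR : ∀ α : Fin n →₀ ℕ, |y α| ≤ R ^ α.degree) (i : Fin (m + 1)) (j : Fin n) {s : ℝ}
    (hs : s ^ 2 = 1) (p : MvPolynomial (Fin n) ℝ) :
    0 ≤ rieszLin y ((C R + C s * X j) * (withUnit g i * p ^ 2)) := by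
  have h1 := positiveSeqs_mul_X_sq_le hy hR hyR i j p
  have h2 := hy.2 i ((C R + C s * X j) * p)
  have he : withUnit g i * ((C R + C s * X j) * p) ^ 2 =
      (2 * R) • ((C R + C s * X j) * (withUnit g i * p ^ 2))
        + (s ^ 2) • (withUnit g i * (X j * p) ^ 2) - (R ^ 2) • (withUnit g i * p ^ 2) := by
    simp only [smul_eq_C_mul, map_mul, map_pow, map_ofNat]
    ring
  rw [he, map_sub, map_add, map_smul, map_smul, map_smul, hs] at h2
  simp only [smul_eq_mul, one_mul] at h2
  have : 0 ≤ 2 * R * rieszLin y ((C R + C s * X j) * (withUnit g i * p ^ 2)) := by linarith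
  exact nonneg_of_mul_nonneg_right this (by positivity)

/-- The functional `f ↦ ℓ_y(a f) / t`. -/
noncomputable def twist {n : ℕ} (y : MomSeq n) (a : MvPolynomial (Fin n) ℝ) (t : ℝ) : MomSeq n :=
  fun α => t⁻¹ * rieszLin y (a * monomial α 1)

theorem rieszLin_twist {n : ℕ} (y : MomSeq n) (a : MvPolynomial (Fin n) ℝ) (t : ℝ)
    (f : MvPolynomial (Fin n) ℝ) : rieszLin (twist y a t) f = t⁻¹ * rieszLin y (a * f) := by
  have := linearMap_eq_rieszLin (t⁻¹ • rieszLin y ∘ₗ LinearMap.mulLeft ℝ a)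
  exact congrArg (fun L => L f) this

theorem twist_mem_positiveSeqs {n m : ℕ} {g : Fin m → MvPolynomial (Fin n) ℝ} {y : MomSeq n}
    {a : MvPolynomial (Fin n) ℝ} (ha : ∀ i p, 0 ≤ rieszLin y (a * (withUnit g i * p ^ 2)))
    (h : 0 < rieszLin y a) : twist y a (rieszLin y a) ∈ positiveSeqs g := by
  refine ⟨?_, fun i p => ?_⟩
  · rw [← rieszLin_one (twist y a _), rieszLin_twist, mul_one, inv_mul_cancel₀ h.ne']
  · rw [rieszLin_twist]
    exact mul_nonneg (inv_nonneg.2 h.le) (ha i p)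

/-- The weights write `y` as a convex combination of two normalized positive functionals, and
extremality makes both equal to `y`. Using `2R` rather than `R` keeps both masses strictly positive,
as normalization requires. -/
theorem rieszLin_X_mul_of_mem_extremePoints {n m : ℕ} {g : Fin m → MvPolynomial (Fin n) ℝ}
    (hg : ArchimedeanCond g) {y : MomSeq n} (hy : y ∈ (positiveSeqs g).extremePoints ℝ)
    (j : Fin n) (f : MvPolynomial (Fin n) ℝ) :
    rieszLin y (X j * f) = rieszLin y (X j) * rieszLin y f := by
  obtain ⟨R, hR, hbd⟩ := hg.exists_abs_le_of_mem
  have hR0 : 0 < R := by linarith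
  have hyR := hbd y hy.1
  -- the weights `(2R ± x_j) / 4R` sum to one, and both have positive mass
  have hw : ∀ s : ℝ, s ^ 2 = 1 → (∀ i p, 0 ≤ rieszLin y
      (((4 * R)⁻¹ • (C (2 * R) + C s * X j)) * (withUnit g i * p ^ 2))) ∧
      rieszLin y ((4 * R)⁻¹ • (C (2 * R) + C s * X j)) =
        (4 * R)⁻¹ * (2 * R + s * rieszLin y (X j)) := by
    intro s hs
    constructor
    · intro i p
      have h1 := positiveSeqs_mul_linear_nonneg hy.1 hR0 hyR i j hs p
      have h2 := hy.1.2 i p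
      have he : ((4 * R)⁻¹ • (C (2 * R) + C s * X j)) * (withUnit g i * p ^ 2) =
          (4 * R)⁻¹ • ((C R + C s * X j) * (withUnit g i * p ^ 2)
            + R • (withUnit g i * p ^ 2)) := by
        simp only [smul_eq_C_mul, map_mul, map_ofNat]
        ring
      rw [he, map_smul, map_add, map_smul]
      simp only [smul_eq_mul]
      positivity
    · have he : (C (2 * R) + C s * X j : MvPolynomial (Fin n) ℝ) = (2 * R) • 1 + s • X j := by
        simp [smul_eq_C_mul]
      rw [he, map_smul, map_add, map_smul, map_smul, rieszLin_one, hy.1.1]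
      simp
  have hXR : |rieszLin y (X j)| ≤ R := by
    have := hyR (Finsupp.single j 1)
    rw [X, rieszLin_monomial, one_mul]
    simpa using this
  obtain ⟨hX1, hX2⟩ := abs_le.1 hXR
  obtain ⟨ha, hat⟩ := hw 1 (by norm_num)
  obtain ⟨hb, hbt⟩ := hw (-1) (by norm_num)
  have hapos : 0 < rieszLin y ((4 * R)⁻¹ • (C (2 * R) + C 1 * X j)) := by
    rw [hat]; exact mul_pos (by positivity) (by linarith)
  have hbpos : 0 < rieszLin y ((4 * R)⁻¹ • (C (2 * R) + C (-1) * X j)) := by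
    rw [hbt]; exact mul_pos (by positivity) (by linarith)
  have hsum : rieszLin y ((4 * R)⁻¹ • (C (2 * R) + C 1 * X j)) +
      rieszLin y ((4 * R)⁻¹ • (C (2 * R) + C (-1) * X j)) = 1 := by
    rw [hat, hbt]; field_simp; ring
  have hpoly : ((4 * R)⁻¹ • (C (2 * R) + C 1 * X j) : MvPolynomial (Fin n) ℝ) +
      (4 * R)⁻¹ • (C (2 * R) + C (-1) * X j) = 1 := by
    have h4 : (C (4 * R)⁻¹ * C (4 * R) : MvPolynomial (Fin n) ℝ) = 1 := by
      rw [← C_mul, inv_mul_cancel₀ (by positivity), C_1]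
    rw [← h4]
    simp only [smul_eq_C_mul, map_mul, map_ofNat, map_neg]
    ring
  have heq := hy.2 (twist_mem_positiveSeqs ha hapos) (twist_mem_positiveSeqs hb hbpos) (by
    refine ⟨_, _, hapos, hbpos, hsum, ?_⟩
    funext α
    simp only [Pi.add_apply, Pi.smul_apply, smul_eq_mul, twist]
    rw [mul_inv_cancel_left₀ hapos.ne', mul_inv_cancel_left₀ hbpos.ne', ← map_add, ← add_mul,
      hpoly, one_mul, rieszLin_monomial, one_mul])
  have hf := congrArg (fun z => rieszLin z f) heq
  simp only [rieszLin_twist] at hf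
  rw [inv_mul_eq_iff_eq_mul₀ hapos.ne', hat] at hf
  have he : ((4 * R)⁻¹ • (C (2 * R) + C 1 * X j) : MvPolynomial (Fin n) ℝ) * f =
      (4 * R)⁻¹ • ((2 * R) • f + X j * f) := by
    simp only [smul_eq_C_mul, map_mul, map_ofNat, map_one]
    ring
  rw [he, map_smul, map_add, map_smul, smul_eq_mul, smul_eq_mul,
    mul_assoc (4 * R)⁻¹ (2 * R + 1 * _)] at hf
  -- What remains is `2R ℓ(f) + ℓ(x_j f) = (2R + ℓ(x_j)) ℓ(f)`.
  have := mul_left_cancel₀ (inv_ne_zero (by positivity : (4 * R) ≠ 0)) hf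
  linarith

/-- The extreme points of `positiveSeqs g` are the point evaluations in the semialgebraic set. -/
theorem exists_eq_of_mem_extremePoints {n m : ℕ} {g : Fin m → MvPolynomial (Fin n) ℝ}
    (hg : ArchimedeanCond g) {y : MomSeq n} (hy : y ∈ (positiveSeqs g).extremePoints ℝ) :
    ∃ c ∈ semialgSet g, y = fun α => ∏ i, c i ^ α i := by
  let c : Fin n → ℝ := fun j => rieszLin y (X j)
  have hc : ∀ f, rieszLin y f = eval c f := by
    intro f
    induction f using MvPolynomial.induction_on with
    | C a =>
      rw [C_apply, rieszLin_monomial, hy.1.1, ← C_apply, eval_C, mul_one]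
    | add p q hp hq => rw [map_add, map_add, hp, hq]
    | mul_X p j hp =>
      rw [mul_comm, rieszLin_X_mul_of_mem_extremePoints hg hy, hp, map_mul, eval_X]
  refine ⟨c, fun i => ?_, ?_⟩
  · have := hy.1.2 i.succ 1
    rwa [one_pow, mul_one, withUnit, Fin.cons_succ, hc] at this
  · funext α
    have := rieszLin_monomial y α 1
    rw [one_mul, hc, eval_monomial, one_mul] at this
    rw [← this, Finsupp.prod_fintype _ _ fun i => pow_zero _]

/-! ### Representing measures and their uniqueness -/

theorem isClosed_semialgSet {n m : ℕ} (g : Fin m → MvPolynomial (Fin n) ℝ) :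
    IsClosed (semialgSet g) := by
  simp only [semialgSet, Set.ofPred_forall]
  exact isClosed_iInter fun i => isClosed_le continuous_const (continuous_eval (g i))

theorem withUnit_eval_nonneg {n m : ℕ} {g : Fin m → MvPolynomial (Fin n) ℝ} {x : Fin n → ℝ}
    (hx : x ∈ semialgSet g) (i : Fin (m + 1)) : 0 ≤ eval x (withUnit g i) := by
  refine Fin.cases ?_ (fun i => ?_) i
  · simp [withUnit]
  · simpa [withUnit] using hx i

/-- Evaluation at a point of `X` is a positive functional, so the bound with `p = 1` gives `x_j² ≤
R²`. -/
theorem ArchimedeanCond.isCompact_semialgSet {n m : ℕ} {g : Fin m → MvPolynomial (Fin n) ℝ}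
    (hg : ArchimedeanCond g) : IsCompact (semialgSet g) := by
  obtain ⟨R, hR, D₀, h⟩ := hg.exists_mul_sq_le
  have hc : IsCompact (Set.univ.pi fun _ : Fin n => Set.Icc (-R) R) :=
    isCompact_univ_pi fun _ => isCompact_Icc
  refine hc.of_isClosed_subset (isClosed_semialgSet g) fun x hx j _ => ?_
  have hL : NonnegUpTo g D₀ (aeval x).toLinearMap := fun i p _ => by
    have := mul_nonneg (withUnit_eval_nonneg hx i) (sq_nonneg (eval x p))
    simpa [coe_aeval_eq_eval] using this
  have := h D₀ _ hL j 1 (by simp)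
  exact abs_le.1 (abs_le_of_sq_le_sq (by simpa using this) (by linarith))

theorem integrable_of_isCompact {n : ℕ} {μ : Measure (Fin n → ℝ)} [IsFiniteMeasure μ]
    {K : Set (Fin n → ℝ)} (hK : IsCompact K) (hμ : μ Kᶜ = 0) {f : (Fin n → ℝ) → ℝ}
    (hf : Continuous f) : Integrable f μ := by
  have h := hf.continuousOn.integrableOn_compact (μ := μ) hK
  rwa [IntegrableOn, Measure.restrict_eq_self_of_ae_mem (mem_ae_iff.2 hμ)] at h

theorem rieszLin_momentSeq {n : ℕ} {μ : Measure (Fin n → ℝ)} [IsFiniteMeasure μ]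
    {K : Set (Fin n → ℝ)} (hK : IsCompact K) (hμ : μ Kᶜ = 0) (f : MvPolynomial (Fin n) ℝ) :
    rieszLin (momentSeq μ) f = ∫ x, eval x f ∂μ := by
  rw [rieszLin_apply, riesz]
  simp only [eval_eq', momentSeq]
  rw [integral_finsetSum]
  · simp only [integral_const_mul]
  · intro α _
    exact integrable_of_isCompact hK hμ (by fun_prop)

theorem momentSeq_mem_positiveSeqs {n m : ℕ} {g : Fin m → MvPolynomial (Fin n) ℝ}
    (hg : ArchimedeanCond g) {μ : Measure (Fin n → ℝ)} [IsFiniteMeasure μ]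
    (hμ : μ (semialgSet g)ᶜ = 0) (h0 : momentSeq μ 0 = 1) :
    momentSeq μ ∈ positiveSeqs g := by
  refine ⟨h0, fun i p => ?_⟩
  rw [rieszLin_momentSeq hg.isCompact_semialgSet hμ]
  refine integral_nonneg_of_ae ?_
  filter_upwards [mem_ae_iff.2 hμ] with x hx
  rw [map_mul, map_pow]
  exact mul_nonneg (withUnit_eval_nonneg hx i) (sq_nonneg _)

/-- A sequence that is nonnegative on an Archimedean quadratic module is the moment sequence of a
probability measure on the semialgebraic set (Putinar). -/
theorem exists_eq_momentSeq {n m : ℕ} {g : Fin m → MvPolynomial (Fin n) ℝ}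
    (hg : ArchimedeanCond g) {y : MomSeq n} (hy : y ∈ positiveSeqs g) :
    ∃ μ : Measure (Fin n → ℝ), IsProbabilityMeasure μ ∧ μ (semialgSet g)ᶜ = 0 ∧
      y = momentSeq μ := by
  have : CompactSpace (semialgSet g) := isCompact_iff_compactSpace.1 hg.isCompact_semialgSet
  let mon : (Fin n →₀ ℕ) → BoundedContinuousFunction (semialgSet g) ℝ := fun α =>
    BoundedContinuousFunction.mkOfCompact ⟨fun x => ∏ i, x.1 i ^ α i,
      continuous_finsetProd _ fun i _ => ((continuous_apply i).comp continuous_subtype_val).pow _⟩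
  let Φ : ProbabilityMeasure (semialgSet g) → MomSeq n := fun ν α => ∫ x, mon α x ∂ν
  have hΦ : Continuous Φ := continuous_pi fun α =>
    ProbabilityMeasure.continuous_integral_boundedContinuousFunction (mon α)
  have hconv : Convex ℝ (Set.range Φ) := by
    rintro _ ⟨ν₁, rfl⟩ _ ⟨ν₂, rfl⟩ a b ha hb hab
    have hp : IsProbabilityMeasure
        (ENNReal.ofReal a • (ν₁ : Measure (semialgSet g)) + 
          ENNReal.ofReal b • (ν₂ : Measure (semialgSet g))) :=
      ⟨by simp [← ENNReal.ofReal_add ha hb, hab]⟩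
    refine ⟨⟨_, hp⟩, ?_⟩
    funext α
    have hi : ∀ ν : ProbabilityMeasure (semialgSet g), Integrable (mon α) ν := fun ν =>
      (mon α).integrable _
    simp only [Φ, Pi.add_apply, Pi.smul_apply, smul_eq_mul, ProbabilityMeasure.coe_mk]
    rw [integral_add_measure ((hi ν₁).smul_measure ENNReal.ofReal_ne_top)
      ((hi ν₂).smul_measure ENNReal.ofReal_ne_top), integral_smul_measure, integral_smul_measure,
      ENNReal.toReal_ofReal ha, ENNReal.toReal_ofReal hb, smul_eq_mul, smul_eq_mul]
  have hext : (positiveSeqs g).extremePoints ℝ ⊆ Set.range Φ := by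
    intro z hz
    obtain ⟨c, hc, rfl⟩ := exists_eq_of_mem_extremePoints hg hz
    refine ⟨⟨Measure.dirac ⟨c, hc⟩, inferInstance⟩, ?_⟩
    funext α
    simp only [Φ, ProbabilityMeasure.coe_mk, integral_dirac]
    rfl
  have hy' : y ∈ closure (convexHull ℝ ((positiveSeqs g).extremePoints ℝ)) := by
    rwa [closure_convexHull_extremePoints hg.isCompact_positiveSeqs (convex_positiveSeqs g)]
  -- Probability measures on compact `X` form a compact space, so their moment sequences form a
  -- closed convex set, which contains the closed convex hull of the evaluations.
  obtain ⟨ν, rfl⟩ := closure_minimal (convexHull_min hext hconv)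
    (isCompact_range hΦ).isClosed hy'
  have hm : MeasurableSet (semialgSet g) := (isClosed_semialgSet g).measurableSet
  refine ⟨(ν : Measure (semialgSet g)).map Subtype.val,
    Measure.isProbabilityMeasure_map measurable_subtype_coe.aemeasurable, ?_, ?_⟩
  · rw [Measure.map_apply measurable_subtype_coe hm.compl]
    simp
  · funext α
    simp only [Φ, momentSeq]
    rw [(MeasurableEmbedding.subtype_coe hm).integral_map]
    rfl

/-- Finite measures on a compact set with the same moments are equal. -/
theorem measure_eq_of_momentSeq_eq {n : ℕ} {μ ν : Measure (Fin n → ℝ)} [IsFiniteMeasure μ]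
    [IsFiniteMeasure ν] {K : Set (Fin n → ℝ)} (hK : IsCompact K) (hμ : μ Kᶜ = 0) (hν : ν Kᶜ = 0)
    (h : momentSeq μ = momentSeq ν) : μ = ν := by
  have : CompactSpace K := isCompact_iff_compactSpace.1 hK
  have hm : MeasurableSet K := hK.measurableSet
  have hemb := MeasurableEmbedding.subtype_coe hm
  have hmap : ∀ ρ : Measure (Fin n → ℝ), ρ Kᶜ = 0 →
      (ρ.comap (Subtype.val : K → Fin n → ℝ)).map Subtype.val = ρ := fun ρ hρ => by
    rw [hemb.map_comap, Subtype.range_coe, Measure.restrict_eq_self_of_ae_mem (mem_ae_iff.2 hρ)]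
  let φ : MvPolynomial (Fin n) ℝ →ₐ[ℝ] BoundedContinuousFunction K ℝ :=
    aeval fun i => BoundedContinuousFunction.mkOfCompact ⟨fun x => x.1 i,
      (continuous_apply i).comp continuous_subtype_val⟩
  have hφ : ∀ (p : MvPolynomial (Fin n) ℝ) (x : K), φ p x = eval x.1 p := by
    intro p x
    induction p using MvPolynomial.induction_on with
    | C a => simp [φ]
    | add p q hp hq => simp [hp, hq]
    | mul_X p i hp =>
      rw [map_mul, map_mul, BoundedContinuousFunction.mul_apply, hp]
      simp [φ]
  -- Polynomial functions separate the points of `K`, so their integrals determine a finite measure.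
  let A : StarSubalgebra ℝ (BoundedContinuousFunction K ℝ) :=
    { φ.range with
      star_mem' := fun {a} ha => by
        have : star a = a := by ext x; simp
        rwa [this] }
  have hsep : (A.map (BoundedContinuousFunction.toContinuousMapStarₐ ℝ)).SeparatesPoints := by
    intro x y hxy
    obtain ⟨i, hi⟩ : ∃ i, x.1 i ≠ y.1 i := by
      by_contra! hall
      exact hxy (Subtype.ext (funext hall))
    refine ⟨φ (X i), ⟨_, ⟨φ (X i), ⟨X i, rfl⟩, rfl⟩, rfl⟩, ?_⟩
    rwa [hφ, hφ, eval_X, eval_X]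
  have hcomap : μ.comap (Subtype.val : K → Fin n → ℝ) = ν.comap Subtype.val := by
    have hfin : ∀ ρ : Measure (Fin n → ℝ), [IsFiniteMeasure ρ] →
        IsFiniteMeasure (ρ.comap (Subtype.val : K → Fin n → ℝ)) := fun ρ _ => inferInstance
    have := hfin μ
    have := hfin ν
    refine ext_of_forall_mem_subalgebra_integral_eq_of_polish hsep ?_
    rintro _ ⟨p, rfl⟩
    change ∫ x, φ p x ∂_ = ∫ x, φ p x ∂_
    simp only [hφ]
    rw [← hemb.integral_map (fun x => eval x p), ← hemb.integral_map (fun x => eval x p),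
      hmap μ hμ, hmap ν hν, ← rieszLin_momentSeq hK hμ, ← rieszLin_momentSeq hK hν, h]
  rw [← hmap μ hμ, hcomap, hmap ν hν]

/-! ### The relaxations and the infinite-dimensional problem -/

theorem totalDegree_polyPow_le {n : ℕ} (T : Fin n → MvPolynomial (Fin n) ℝ) (α : Fin n →₀ ℕ) :
    (polyPow T α).totalDegree ≤ α.degree * mapDegree T := by
  refine (totalDegree_finsetProd _ _).trans ?_
  rw [Finsupp.degree_eq_sum, Finset.sum_mul]
  refine Finset.sum_le_sum fun i _ => (totalDegree_pow _ _).trans ?_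
  exact Nat.mul_le_mul_left _
    (Finset.le_sup (f := fun i => (T i).totalDegree) (Finset.mem_univ i))

theorem eval_polyPow {n : ℕ} (T : Fin n → MvPolynomial (Fin n) ℝ) (α : Fin n →₀ ℕ)
    (x : Fin n → ℝ) : eval x (polyPow T α) = ∏ i, polyMap T x i ^ α i := by
  simp [polyPow, polyMap, map_prod]

theorem continuous_polyMap {n : ℕ} (T : Fin n → MvPolynomial (Fin n) ℝ) :
    Continuous (polyMap T) :=
  continuous_pi fun i => continuous_eval (T i)

theorem le_relaxDegree {n : ℕ} {T : Fin n → MvPolynomial (Fin n) ℝ} (hT : 1 ≤ mapDegree T)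
    (k : ℕ) : k ≤ relaxDegree T k :=
  Nat.le_mul_of_pos_right k hT

theorem extend_truncation {n d : ℕ} (z : MomSeq n) {α : Fin n →₀ ℕ} (hα : α.degree ≤ d) :
    TruncSeq.extend (fun β : {β : Fin n →₀ ℕ // β.degree ≤ d} => z β.1) α = z α := by
  simp [TruncSeq.extend, hα]

theorem mem_positiveSeqs_of_mem_lpFeasible {n m : ℕ} {T : Fin n → MvPolynomial (Fin n) ℝ}
    {g : Fin m → MvPolynomial (Fin n) ℝ} (hg : ArchimedeanCond g) {z : MomSeq n}
    (hz : z ∈ lpFeasible T g) : z ∈ positiveSeqs g := by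
  obtain ⟨⟨μ, hfin, hμ, rfl⟩, -, h0⟩ := hz
  exact momentSeq_mem_positiveSeqs hg hμ h0

/-- Every polynomial in the order `k` constraints has degree at most `d_k`, so the truncation does
not change its Riesz value. -/
theorem truncation_mem_relaxFeasible {n m : ℕ} {T : Fin n → MvPolynomial (Fin n) ℝ}
    {g : Fin m → MvPolynomial (Fin n) ℝ} (hT : 1 ≤ mapDegree T) (hg : ArchimedeanCond g)
    {z : MomSeq n} (hz : z ∈ lpFeasible T g) (k : ℕ) :
    (fun β => z β.1 : TruncSeq n (relaxDegree T k)) ∈ relaxFeasible T g k := by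
  have hcongr : ∀ f : MvPolynomial (Fin n) ℝ, f.totalDegree ≤ relaxDegree T k →
      rieszLin (TruncSeq.extend (fun β => z β.1 : TruncSeq n (relaxDegree T k))) f =
        rieszLin z f := fun f hf => rieszLin_congr (fun α hα => extend_truncation z hα) hf
  refine ⟨fun α hα => ?_, ?_, fun i => ?_⟩
  · rw [← rieszLin_apply, ← rieszLin_apply, hcongr, hcongr, rieszLin_apply, rieszLin_apply]
    · exact hz.2.1 α
    · rw [totalDegree_monomial_one]
      exact hα.trans (le_relaxDegree hT k)
    · exact (totalDegree_polyPow_le T α).trans (Nat.mul_le_mul_right _ hα)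
  · rw [extend_truncation z (by simp)]
    exact hz.2.2
  · rw [posSemidef_locMatrix_iff]
    intro p hp
    rw [hcongr]
    · exact (mem_positiveSeqs_of_mem_lpFeasible hg hz).2 i p
    · have h1 := totalDegree_mul (withUnit g i) (p ^ 2)
      have h2 := totalDegree_pow p 2
      omega

/-- An optimal moment sequence is represented by an invariant probability measure. -/
theorem exists_isOptimalInvariant {n m : ℕ} {T : Fin n → MvPolynomial (Fin n) ℝ}
    {g : Fin m → MvPolynomial (Fin n) ℝ} {F : MomSeq n → EReal} (hg : ArchimedeanCond g)
    {z : MomSeq n} (hz : z ∈ lpFeasible T g) (hopt : ∀ w ∈ lpFeasible T g, F z ≤ F w) :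
    ∃ μ, IsOptimalInvariant T g F μ ∧ z = momentSeq μ := by
  have hz' := hz
  obtain ⟨⟨μ, hfin, hμ, rfl⟩, hinv, h0⟩ := hz'
  have hX := hg.isCompact_semialgSet
  have hT := continuous_polyMap T
  have hprob : IsProbabilityMeasure μ := by
    refine ⟨?_⟩
    have h : momentSeq μ 0 = μ.real Set.univ := by simp [momentSeq]
    rw [h, Measure.real] at h0
    rwa [ENNReal.toReal_eq_one_iff] at h0
  -- `T` need not map `X` into itself, so `μ` and its image are compared on `X ∪ T(X)`.
  have hK : IsCompact (semialgSet g ∪ polyMap T '' semialgSet g) := hX.union (hX.image hT)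
  have hμK : μ (semialgSet g ∪ polyMap T '' semialgSet g)ᶜ = 0 :=
    measure_mono_null (Set.compl_subset_compl.2 Set.subset_union_left) hμ
  have hνK : (μ.map (polyMap T)) (semialgSet g ∪ polyMap T '' semialgSet g)ᶜ = 0 := by
    rw [Measure.map_apply hT.measurable hK.measurableSet.compl]
    refine measure_mono_null (fun x hx hxX => hx (Or.inr ⟨x, hxX, rfl⟩)) hμ
  have hmap : μ.map (polyMap T) = μ := by
    refine measure_eq_of_momentSeq_eq hK hνK hμK (funext fun α => ?_)
    have h := hinv α
    rw [← rieszLin_apply, ← rieszLin_apply, rieszLin_monomial, one_mul,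
      rieszLin_momentSeq hX hμ] at h
    rw [← h, momentSeq, integral_map hT.measurable.aemeasurable
      (Continuous.aestronglyMeasurable (by fun_prop))]
    simp only [eval_polyPow]
  refine ⟨μ, ⟨hprob, hμ, fun A hA => ?_, hz, hopt⟩, rfl⟩
  rw [← Measure.map_apply hT.measurable hA, hmap]

theorem IsRelaxSolution.nonnegUpTo {n m k : ℕ} {T : Fin n → MvPolynomial (Fin n) ℝ}
    {g : Fin m → MvPolynomial (Fin n) ℝ} {F : MomSeq n → EReal}
    {y : TruncSeq n (relaxDegree T k)} (hy : IsRelaxSolution T g F k y) :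
    NonnegUpTo g (relaxDegree T k) (rieszLin y.extend) := fun i p hp =>
  (posSemidef_locMatrix_iff _ _).1 (hy.1.2.2 i) p hp

theorem exists_subseq_tendsto_of_bounded {n : ℕ} {u : ℕ → MomSeq n}
    (h : ∀ α, ∃ B : ℝ, ∀ᶠ k in atTop, |u k α| ≤ B) :
    ∃ (z : MomSeq n) (φ : ℕ → ℕ), StrictMono φ ∧ Tendsto (u ∘ φ) atTop (𝓝 z) := by
  have h' : ∀ α, ∃ B : ℝ, ∀ k, |u k α| ≤ B := by
    intro α
    obtain ⟨B, hB⟩ := h α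
    obtain ⟨N, hN⟩ := eventually_atTop.1 hB
    -- The sum covers the finitely many terms before the bound sets in.
    refine ⟨max B (∑ k ∈ Finset.range N, |u k α|), fun k => ?_⟩
    rcases lt_or_ge k N with hk | hk
    · exact le_max_of_le_right (Finset.single_le_sum (f := fun k => |u k α|)
        (fun _ _ => abs_nonneg _) (Finset.mem_range.2 hk))
    · exact le_max_of_le_left (hN k hk)
  choose B hB using h'
  have hc : IsCompact (Set.univ.pi fun α => Set.Icc (-B α) (B α)) :=
    isCompact_univ_pi fun _ => isCompact_Icc
  obtain ⟨z, -, φ, hφ, hz⟩ := hc.tendsto_subseq (x := u) fun k α _ => abs_le.1 (hB α k)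
  exact ⟨z, φ, hφ, hz⟩

/-- Every sequence of orders has a subsequence along which the optimal solutions of the relaxations
converge to a feasible point of the infinite-dimensional problem. -/
theorem exists_subseq_tendsto_lpFeasible {n m : ℕ} {T : Fin n → MvPolynomial (Fin n) ℝ}
    {g : Fin m → MvPolynomial (Fin n) ℝ} {F : MomSeq n → EReal} (hT : 1 ≤ mapDegree T)
    (hg : ArchimedeanCond g) {y : (k : ℕ) → TruncSeq n (relaxDegree T k)}
    (hy : ∀ᶠ k in atTop, IsRelaxSolution T g F k (y k)) {v : ℕ → ℕ} (hv : Tendsto v atTop atTop) :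
    ∃ z ∈ lpFeasible T g, ∃ φ : ℕ → ℕ, StrictMono φ ∧
      Tendsto (fun j => (y (v (φ j))).extend) atTop (𝓝 z) := by
  obtain ⟨R, hR, D₀, hbd⟩ := hg.exists_abs_le
  have hb : ∀ α, ∃ B : ℝ, ∀ᶠ k in atTop, |(y (v k)).extend α| ≤ B := by
    intro α
    refine ⟨R ^ α.degree, hv.eventually (p := fun k => |(y k).extend α| ≤ R ^ α.degree) ?_⟩
    filter_upwards [hy, eventually_ge_atTop (2 * α.degree + D₀)] with k hk hkα
    exact hbd _ _ hk.nonnegUpTo hk.1.2.1 α (hkα.trans (le_relaxDegree hT k))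
  obtain ⟨z, φ, hφ, hz⟩ := exists_subseq_tendsto_of_bounded hb
  have hvφ : Tendsto (fun j => v (φ j)) atTop atTop := hv.comp hφ.tendsto_atTop
  have hlim : ∀ f, Tendsto (fun j => rieszLin (y (v (φ j))).extend f) atTop (𝓝 (rieszLin z f)) :=
    fun f => ((continuous_rieszLin f).tendsto z).comp hz
  have hpos : z ∈ positiveSeqs g := by
    refine ⟨?_, fun i p => ?_⟩
    · rw [← rieszLin_one z]
      refine tendsto_nhds_unique (hlim 1) (tendsto_const_nhds.congr' ?_)
      filter_upwards [hvφ.eventually hy] with j hj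
      rw [rieszLin_one, hj.1.2.1]
    · refine ge_of_tendsto (hlim _) ?_
      filter_upwards [hvφ.eventually hy, hvφ.eventually (eventually_ge_atTop
        ((withUnit g i).totalDegree + 2 * p.totalDegree))] with j hj hji
      exact hj.nonnegUpTo i p (hji.trans (le_relaxDegree hT _))
  refine ⟨z, ⟨?_, fun α => ?_, hpos.1⟩, φ, hφ, hz⟩
  · obtain ⟨μ, hprob, hμ, rfl⟩ := exists_eq_momentSeq hg hpos
    exact ⟨μ, inferInstance, hμ, rfl⟩
  · rw [← rieszLin_apply, ← rieszLin_apply]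
    refine tendsto_nhds_unique (hlim _) ((hlim _).congr' ?_)
    filter_upwards [hvφ.eventually hy, hvφ.eventually (eventually_ge_atTop α.degree)] with j hj hjα
    rw [rieszLin_apply, rieszLin_apply]
    exact (hj.1.1 α hjα).symm

theorem eventually_le_of_mem_lpFeasible {n m : ℕ} {T : Fin n → MvPolynomial (Fin n) ℝ}
    {g : Fin m → MvPolynomial (Fin n) ℝ} {F : MomSeq n → EReal} (hT : 1 ≤ mapDegree T)
    (hg : ArchimedeanCond g) (hFdep : ∃ d : ℕ, DependsOnDegreeLE F d)
    {y : (k : ℕ) → TruncSeq n (relaxDegree T k)}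
    (hy : ∀ᶠ k in atTop, IsRelaxSolution T g F k (y k)) :
    ∀ᶠ k in atTop, ∀ z ∈ lpFeasible T g, F (y k).extend ≤ F z := by
  obtain ⟨d, hd⟩ := hFdep
  filter_upwards [hy, eventually_ge_atTop d] with k hk hkd z hz
  refine (hk.2 _ (truncation_mem_relaxFeasible hT hg hz k)).trans_eq (hd _ _ fun α hα => ?_)
  exact extend_truncation z (hα.trans (hkd.trans (le_relaxDegree hT k)))

end

/-! ### Convergence -/

theorem theorem2 {n m : ℕ} (T : Fin n → MvPolynomial (Fin n) ℝ)
    (g : Fin m → MvPolynomial (Fin n) ℝ) (F : MomSeq n → EReal)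
    -- `T` is not constant, so that `k ≤ d_k` and the relaxations are defined
    (hT : 1 ≤ mapDegree T)
    (hg : ArchimedeanCond g)
    -- `F` takes values in `(-∞, +∞]`, is convex, and depends on finitely many moments only
    (hFbot : ∀ y, F y ≠ ⊥) (hFconv : ConvexEReal F)
    (hFdep : ∃ d : ℕ, DependsOnDegreeLE F d)
    (hFlsc : LowerSemicontinuous F)
    (y : (k : ℕ) → TruncSeq n (relaxDegree T k))
    (hy : ∀ᶠ k in atTop, IsRelaxSolution T g F k (y k)) :
    Tendsto (fun k => F (y k).extend) atTop (𝓝 (lpValue T g F)) ∧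
    (∃ φ : ℕ → ℕ, StrictMono φ ∧ ∃ μ : Measure (Fin n → ℝ), IsOptimalInvariant T g F μ ∧
      ∀ α, Tendsto (fun j => (y (φ j)).extend α) atTop (𝓝 (momentSeq μ α))) ∧
    (∀ μ : Measure (Fin n → ℝ), IsOptimalInvariant T g F μ →
      (∀ ν : Measure (Fin n → ℝ), IsOptimalInvariant T g F ν → ν = μ) →
      ∀ α, Tendsto (fun k => (y k).extend α) atTop (𝓝 (momentSeq μ α))) := by

  have hle := eventually_le_of_mem_lpFeasible hT hg hFdep hy
  have hopt : ∀ (v : ℕ → ℕ), Tendsto v atTop atTop → ∀ z,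
      Tendsto (fun j => (y (v j)).extend) atTop (𝓝 z) → ∀ w ∈ lpFeasible T g, F z ≤ F w := by
    intro v hv z hz w hw
    -- If `F w < F z`, lower semicontinuity forces `F w < F(y^k)` far along the sequence, against
    -- `hle`.
    by_contra! hlt
    obtain ⟨j, hj1, hj2⟩ := ((hz.eventually (hFlsc z _ hlt)).and (hv.eventually hle)).exists
    exact (hj2 w hw).not_gt hj1
  have hsub : ∀ v : ℕ → ℕ, Tendsto v atTop atTop → ∃ φ : ℕ → ℕ, StrictMono φ ∧
      ∃ μ, IsOptimalInvariant T g F μ ∧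
        Tendsto (fun j => (y (v (φ j))).extend) atTop (𝓝 (momentSeq μ)) := by
    intro v hv
    obtain ⟨z, hz, φ, hφ, hlim⟩ := exists_subseq_tendsto_lpFeasible hT hg hy hv
    obtain ⟨μ, hμ, rfl⟩ := exists_isOptimalInvariant hg hz
      (hopt (fun j => v (φ j)) (hv.comp hφ.tendsto_atTop) _ hlim)
    exact ⟨φ, hφ, μ, hμ, hlim⟩
  refine ⟨?_, ?_, ?_⟩
  · refine tendsto_of_subseq_tendsto fun v hv => ?_
    obtain ⟨φ, hφ, μ, hμ, hlim⟩ := hsub v hv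
    refine ⟨φ, tendsto_order.2 ⟨fun a ha => ?_, fun a ha => ?_⟩⟩
    · exact hlim.eventually (hFlsc _ a (ha.trans_le (iInf₂_le _ hμ.feasible)))
    · filter_upwards [(hv.comp hφ.tendsto_atTop).eventually hle] with j hj
      exact (le_iInf₂ hj).trans_lt ha
  · obtain ⟨φ, hφ, μ, hμ, hlim⟩ := hsub id tendsto_id
    exact ⟨φ, hφ, μ, hμ, fun α => ((continuous_apply α).tendsto _).comp hlim⟩
  · intro μ _ huniq α
    refine tendsto_of_subseq_tendsto fun v hv => ?_
    obtain ⟨φ, -, ν, hν, hlim⟩ := hsub v hv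
    rw [huniq ν hν] at hlim
    exact ⟨φ, ((continuous_apply α).tendsto _).comp hlim⟩
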